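/- Let $\Phi\subset V$ be an irreducible (reduced, crystallographic) root system in a finite-dimensional real vector space $V$, with simple roots $\Pi=\{\alpha_1,\dots,\alpha_r\}$, positive roots $\Phi^+$, Weyl group $W$, and highest root $\alpha_0=\sum_{i=1}^r n_i\alpha_i$. Let $V^*$ be the dual space, with its usual topology, $\langle\cdot,\cdot\rangle$ the pairing between $V^*$ and $V$, $P^\vee=\{\lambda\in V^* : \langle\lambda,\alpha\rangle\in\mathbb Z\ \forall\alpha\in\Phi\}$ the coweight lattice and $\varpi_1^\vee,\dots,\varpi_r^\vee\in V^*$ the fundamental coweights, $\langle\varpi_i^\vee,\alpha_j\rangle=\delta_{ij}$. For $x\in V^*$ let $\mathrm t_x$ be the translation of $V^*$ by $x$. The extended affine Weyl group $\widehat W_{\mathrm a}=\mathrm t(P^\vee)\rtimes W$ acts on $V^*$ by affine transformations. Put $$\mathcal A_0=\{\lambda\in V^* : 0\le\langle\lambda,\alpha\rangle\le 1\ \ \forall \alpha\in\Phi^+\},\qquad \Omega=\{\phi\in\widehat W_{\mathrm a} : \phi(\mathcal A_0)=\mathcal A_0\},\qquad J=\{i : n_i=1\}$$ ($\mathcal A_0$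 is the closed fundamental alcove, and $J$ is the set of minuscule indices). For $i\in J$ let $\omega_i=\mathrm t_{\varpi_i^\vee}w_0^iw_0$, where $w_0$ is the longest element of $W$ and $w_0^i$ is the longest element of the subgroup of $W$ generated by the simple reflections $s_{\alpha_j}$, $j\ne i$. Let $$F_{P^\vee}=\{\lambda\in\mathcal A_0 : \langle\lambda,\alpha_i+\alpha_0\rangle\le 1\ \ \forall i\in J\}.$$ A fundamental domain for the action of a group $G$ on a topological space $Z$ is a closed connected subset $\mathcal F\subseteq Z$ such that $\mathcal F\cap g\mathcal F$ has empty interior in $Z$ for every $1\ne g\in G$ and $Z=\bigcup_{g\in G}g\mathcal F$. Then: 1. $F_{P^\vee}$ is a fundamental domain for the action of $\Omega$ on $\mathcal A_0$. 2. The map $i\mapsto\omega_i$ is a bijection from $J$ onto $\Omega\setminus\{1\}$, and for $\lambda\in F_{P^\vee}$ the elements $\omega_i^{-1}\in\Omega$ ($i\in J$) that send $\lambda$ into $F_{P^\vee}$ are precisely those with $\langle\lambda,\alpha_i+\alpha_0\rangle=1$. 3. In particular, if $\lambda$ is an interior point of $F_{P^\vee}$ in $V^*$ and $1\ne\widehat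 w\in\widehat W_{\mathrm a}$, then $\widehat w(\lambda)\notin F_{P^\vee}$. -/

import Mathlib

noncomputable section

/-! ## Fundamental domains -/

/-- A fundamental domain for the action of a group `G` on a topological space `Z`: a closed
connected subspace, meeting each of its non-trivial translates in a set with empty interior, and
whose translates cover `Z`. -/
structure IsTopFundamentalDomain (G : Type*) {Z : Type*} [Group G] [TopologicalSpace Z]
    [MulAction G Z] (F : Set Z) : Prop where
  isClosed : IsClosed F
  isConnected : IsConnected F
  interior_inter_eq_empty : ∀ g : G, g ≠ 1 → interior (F ∩ (fun z => g • z) '' F) = ∅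
  iUnion_eq_univ : ⋃ g : G, (fun z => g • z) '' F = Set.univ

namespace ExtAffineWeyl

/-! Throughout, `V` is the ambient space of a real root system `Φ` (given by `P`), `V'` is its dual
space `V^*` through the pairing of `P`, and `b` is a system of simple roots. The value `⟨λ, x⟩` of
the pairing, for `λ` in `V'` and `x` in `V`, is `P.toLinearMap x λ`. -/

variable {ι V V' : Type*} [AddCommGroup V] [Module ℝ V] [AddCommGroup V'] [Module ℝ V']

/-! ## Roots and coweights -/

section Roots

variable {P : RootPairing ι ℝ V V'} (b : P.Base)

/-- `x` is a highest root: it is a root, and `α ≤ x` for every root `α`, that is, `x - α` is a sum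
of simple roots. -/
def IsHighestRoot (x : V) : Prop :=
  x ∈ Set.range P.root ∧
    ∀ i : ι, x - P.root i ∈ AddSubmonoid.closure (P.root '' (b.support : Set ι))

/-- There is at most one highest root. -/
theorem IsHighestRoot.unique {x y : V} (hx : IsHighestRoot b x) (hy : IsHighestRoot b y) :
    x = y := by
  obtain ⟨⟨i, rfl⟩, hi⟩ := hx
  obtain ⟨⟨j, rfl⟩, hj⟩ := hy
  have key : ∀ v ∈ AddSubmonoid.closure (P.root '' (b.support : Set ι)),
      ∃ c : b.support → ℕ, v = ∑ k, (c k : ℝ) • P.root k := by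
    intro v hv
    induction hv using AddSubmonoid.closure_induction with
    | mem v hv =>
      classical
      obtain ⟨k, hk, rfl⟩ := hv
      refine ⟨Pi.single ⟨k, hk⟩ 1, ?_⟩
      rw [Finset.sum_eq_single ⟨k, hk⟩]
      · simp
      · intro l _ hl
        simp [Pi.single_eq_of_ne hl]
      · simp
    | zero => exact ⟨0, by simp⟩
    | add v w _ _ hv hw =>
      obtain ⟨c, rfl⟩ := hv
      obtain ⟨d, rfl⟩ := hw
      exact ⟨c + d, by simp [add_smul, Finset.sum_add_distrib]⟩
  obtain ⟨c, hc⟩ := key _ (hi j)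
  obtain ⟨d, hd⟩ := key _ (hj i)
  have hsum : ∑ k, ((c k : ℝ) + d k) • P.root (k : ι) = 0 := by
    simp only [add_smul, Finset.sum_add_distrib, ← hc, ← hd]
    abel
  have hli : LinearIndependent ℝ (fun k : b.support => P.root (k : ι)) := b.linearIndepOn_root
  have h0 := Fintype.linearIndependent_iff.mp hli _ hsum
  have hc0 : ∀ k, (c k : ℝ) = 0 := fun k => by
    have := h0 k
    have h1 : (0 : ℝ) ≤ c k := Nat.cast_nonneg _
    have h2 : (0 : ℝ) ≤ d k := Nat.cast_nonneg _
    linarith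
  simp only [hc0, zero_smul, Finset.sum_const_zero] at hc
  exact sub_eq_zero.mp hc

/-- The highest root `α₀`. -/
def highestRoot : V := Classical.epsilon (IsHighestRoot b)

variable [P.IsRootSystem]

/-- The coefficient `n_j` of the simple root `α_j` in the highest root. -/
def highestCoeff (j : b.support) : ℝ := b.toWeightBasis.repr (highestRoot b) j

/-- The set `J` of the minuscule indices: those `j` with `n_j = 1`. -/
def minusculeIndices : Set b.support := {j | highestCoeff b j = 1}

/-- The fundamental coweight `ϖ_j^∨`: the basis of `V'` dual to the basis of simple roots. -/
def fundamentalCoweight (j : b.support) : V' :=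
  P.toLinearMap.flip.toPerfPair.symm (b.toWeightBasis.coord j)

theorem pairing_fundamentalCoweight [DecidableEq ι] (i j : b.support) :
    P.toLinearMap (P.root i) (fundamentalCoweight b j) = if i = j then 1 else 0 := by
  rw [fundamentalCoweight, LinearMap.apply_toPerfPair_flip, Module.Basis.coord_apply,
    RootPairing.Base.toWeightBasis_repr_root, Finsupp.single_apply]

end Roots

/-! ## The fundamental alcove and the set `F` -/

section Alcove

variable {P : RootPairing ι ℝ V V'} (b : P.Base)

/-- The closed fundamental alcove `A₀`: all `λ` with `0 ≤ ⟨λ, α⟩ ≤ 1` for every positive root. -/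
def alcove : Set V' :=
  {v | ∀ i : ι, b.IsPos i → 0 ≤ P.toLinearMap (P.root i) v ∧ P.toLinearMap (P.root i) v ≤ 1}

/-- The set `F_{P^∨}`: all `λ` in `A₀` with `⟨λ, α_j + α₀⟩ ≤ 1` for every minuscule index `j`. -/
def fundPolytope [P.IsRootSystem] : Set V' :=
  {v | v ∈ alcove b ∧
    ∀ j ∈ minusculeIndices b, P.toLinearMap (P.root j + highestRoot b) v ≤ 1}

end Alcove

/-! ## The Weyl group and its longest elements -/

section Weyl

variable {P : RootPairing ι ℝ V V'} (b : P.Base)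

/-- The group generated by the simple reflections `s_j`, `j ∈ K`, acting on `V'`. -/
def parabolic (K : Set b.support) : Subgroup (V' ≃ₗ[ℝ] V') :=
  Subgroup.closure ((fun j : b.support => P.coreflection j) '' K)

/-- The Weyl group `W`, acting on `V'`. -/
def weyl : Subgroup (V' ≃ₗ[ℝ] V') := parabolic b Set.univ

/-- The length of an element `w` of the Weyl group: the number of positive roots that `w` makes
negative. Since `w (α^∨) = (w α)^∨`, they can be counted on the coroots. -/
def length (w : V' ≃ₗ[ℝ] V') : ℕ :=
  Set.ncard {i : ι | b.IsPos i ∧ ∃ k : ι, ¬ b.IsPos k ∧ P.coroot k = w (P.coroot i)}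

theorem exists_longest [Finite ι] (H : Subgroup (V' ≃ₗ[ℝ] V')) :
    ∃ w ∈ H, ∀ w' ∈ H, length b w' ≤ length b w := by
  have hne : (length b '' (H : Set (V' ≃ₗ[ℝ] V'))).Nonempty := ⟨_, 1, H.one_mem, rfl⟩
  have hbdd : BddAbove (length b '' (H : Set (V' ≃ₗ[ℝ] V'))) := by
    refine ⟨Nat.card ι, ?_⟩
    rintro _ ⟨w, -, rfl⟩
    exact Set.ncard_le_card _
  obtain ⟨w, hw, hw'⟩ := Nat.sSup_mem hne hbdd
  exact ⟨w, hw, fun w' h => by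
    rw [hw']; exact le_csSup hbdd ⟨w', h, rfl⟩⟩

/-- The longest element of the group generated by the `s_j`, `j ∈ K`. -/
def longest [Finite ι] (K : Set b.support) : V' ≃ₗ[ℝ] V' :=
  (exists_longest b (parabolic b K)).choose

end Weyl

/-! ## The extended affine Weyl group and the stabiliser of the alcove -/

section Affine

variable {P : RootPairing ι ℝ V V'} (b : P.Base)

/-- The coweight lattice `P^∨`: the lattice dual to the root lattice. -/
def coweightLattice (P : RootPairing ι ℝ V V') : AddSubgroup V' where
  carrier := {v | ∀ i : ι, ∃ n : ℤ, P.toLinearMap (P.root i) v = n}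
  zero_mem' := fun i => ⟨0, by simp⟩
  add_mem' := by
    intro v w hv hw i
    obtain ⟨n, hn⟩ := hv i
    obtain ⟨m, hm⟩ := hw i
    exact ⟨n + m, by simp [hn, hm]⟩
  neg_mem' := by
    intro v hv i
    obtain ⟨n, hn⟩ := hv i
    exact ⟨-n, by simp [hn]⟩

/-- The translation `t_v`. -/
abbrev trans (v : V') : V' ≃ᵃ[ℝ] V' := AffineEquiv.constVAdd ℝ V' v

theorem weyl_apply_mem_coweightLattice [P.IsCrystallographic] {w : V' ≃ₗ[ℝ] V'} (hw : w ∈ weyl b) :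
    ∀ v ∈ coweightLattice P, w v ∈ coweightLattice P := by
  have hrefl : ∀ j : ι, ∀ v ∈ coweightLattice P, P.coreflection j v ∈ coweightLattice P := by
    intro j v hv i
    obtain ⟨n, hn⟩ := hv i
    obtain ⟨m, hm⟩ := hv j
    obtain ⟨c, hc⟩ := P.exists_value (S := ℤ) i j
    refine ⟨n - m * c, ?_⟩
    have hc' : P.toLinearMap (P.root i) (P.coroot j) = (c : ℝ) := by
      rw [RootPairing.root_coroot_eq_pairing, ← hc]; simp
    simp [RootPairing.coreflection_apply, RootPairing.root', hn, hm, hc']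
  induction hw using Subgroup.closure_induction'' with
  | mem w hw =>
    obtain ⟨j, -, rfl⟩ := hw
    exact hrefl j
  | inv_mem w hw =>
    obtain ⟨j, -, rfl⟩ := hw
    simpa only [RootPairing.coreflection_inv] using hrefl j
  | one => exact fun v hv => hv
  | mul x y _ _ hx hy => exact fun v hv => hx _ (hy _ hv)

/-- The extended affine Weyl group: all the maps `t_x w` with `x` in `P^∨` and `w` in `W`. -/
def extAffineWeyl [P.IsCrystallographic] : Subgroup (V' ≃ᵃ[ℝ] V') where
  carrier := {φ | ∃ x ∈ coweightLattice P, ∃ w ∈ weyl b, φ = trans x * w.toAffineEquiv}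
  one_mem' := ⟨0, zero_mem _, 1, one_mem _, by ext; simp [trans]⟩
  mul_mem' := by
    rintro _ _ ⟨x, hx, w, hw, rfl⟩ ⟨y, hy, u, hu, rfl⟩
    refine ⟨x + w y, add_mem hx (weyl_apply_mem_coweightLattice b hw y hy), w * u,
      mul_mem hw hu, ?_⟩
    ext v
    simp [trans]
  inv_mem' := by
    rintro _ ⟨x, hx, w, hw, rfl⟩
    refine ⟨-(w⁻¹ x), neg_mem (weyl_apply_mem_coweightLattice b (inv_mem hw) x hx), w⁻¹,
      inv_mem hw, ?_⟩
    rw [inv_eq_iff_mul_eq_one]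
    ext v
    simp [trans]

/-- The stabiliser `Ω` of the fundamental alcove in the extended affine Weyl group. -/
def omega [P.IsCrystallographic] : Subgroup (V' ≃ᵃ[ℝ] V') where
  carrier := {φ | φ ∈ extAffineWeyl b ∧ φ '' alcove b = alcove b}
  one_mem' := ⟨one_mem _, by simp⟩
  mul_mem' := by
    rintro φ ψ ⟨hφ, hφ'⟩ ⟨hψ, hψ'⟩
    refine ⟨mul_mem hφ hψ, ?_⟩
    rw [AffineEquiv.coe_mul, Set.image_comp, hψ', hφ']
  inv_mem' := by
    rintro φ ⟨hφ, hφ'⟩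
    refine ⟨inv_mem hφ, ?_⟩
    conv_lhs => rw [← hφ']
    rw [← Set.image_comp, ← AffineEquiv.coe_mul, inv_mul_cancel]
    simp

/-- The action of `Ω` on the alcove. -/
instance omegaAction [P.IsCrystallographic] : MulAction (omega b) (alcove b) where
  smul g v := ⟨(g : V' ≃ᵃ[ℝ] V') v, by
    have h : (g : V' ≃ᵃ[ℝ] V') '' alcove b = alcove b := g.2.2
    exact h.subset (Set.mem_image_of_mem _ v.2)⟩
  one_smul _ := rfl
  mul_smul _ _ _ := rfl

/-- The element `ω_j = t_{ϖ_j^∨} w_0^j w_0`, where `w_0` is the longest element of `W` and `w_0^j`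
is the longest element of the group generated by the simple reflections other than `s_j`. -/
def omegaElt [P.IsRootSystem] [Finite ι] (j : b.support) : V' ≃ᵃ[ℝ] V' :=
  trans (fundamentalCoweight b j) * (longest b {j}ᶜ * longest b Set.univ).toAffineEquiv

end Affine

end ExtAffineWeyl

end

noncomputable section

namespace ExtAffineWeyl

open RootPairing Set Topology Filter

variable {ι V V' : Type*} [AddCommGroup V] [Module ℝ V] [AddCommGroup V'] [Module ℝ V']
  {P : RootPairing ι ℝ V V'} {b : P.Base}

/-! ## Coordinates of positive roots -/

section Coordinates

/-! Everything follows from one identity: the linear part $w_0^jw_0$ of $\omega_j$ sends $\alpha_0$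
to $-\alpha_j$ for minuscule $j$, so
$\langle\omega_j^{-1}\lambda,\alpha_0\rangle=1-\langle\lambda,\alpha_j\rangle$
(`pairing_highestRoot_omegaElt_inv`). Hence the inequality
$\langle\lambda,\alpha_j+\alpha_0\rangle\le1$ says that $\alpha_0$ is no larger at $\lambda$ than at
$\omega_j^{-1}\lambda$. Since the $\omega_j$ exhaust $\Omega\setminus\{1\}$, the polytope consists
of the points of the alcove where $\alpha_0$ is minimal on the $\Omega$-orbit
(`mem_fundPolytope_iff`). As $\Omega$ is finite, minima exist and the translates cover. Two points
of the same orbit both lie in $F$ only if $\alpha_0$ agrees on them, which puts the point on a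
hyperplane $\alpha_j+\alpha_0=1$; such a hyperplane has no interior in the alcove.

That $\Omega\setminus\{1\}=\{\omega_j\}$ is seen from the image of the origin. It is a coweight in
the alcove, so it is $0$ or some $\varpi_j^\vee$ with $n_j=1$; and an element of $\Omega$ fixing $0$
is a Weyl group element keeping the simple roots positive, hence trivial by the exchange condition
(`eq_one_of_forall_isPos`).

For the last claim, an element of the extended group carrying a point of the open alcove into the
alcove preserves the alcove (`mem_omega_of_apply_mem`), so only $\Omega$ matters. -/

theorem root_mem_closure_of_isPos [Finite ι] [P.IsCrystallographic] {i : ι} (hi : b.IsPos i) :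
    P.root i ∈ AddSubmonoid.closure (P.root '' (b.support : Set ι)) := by
  refine hi.induction_on_add
    (p := fun i => P.root i ∈ AddSubmonoid.closure (P.root '' (b.support : Set ι))) (fun j hj => AddSubmonoid.subset_closure ⟨j, hj, rfl⟩) ?_
  intro i j k hk hi hj
  rw [hk]
  exact add_mem hi (AddSubmonoid.subset_closure ⟨j, hj, rfl⟩)

theorem exists_isPos_neg {i : ι} (hi : ¬ b.IsPos i) : ∃ k, b.IsPos k ∧ P.root k = -P.root i := by
  let := P.indexNeg
  exact ⟨-i, (RootPairing.Base.IsPos.neg_iff_not b i).mpr hi, by simp⟩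

theorem not_isPos_of_root_eq_neg {i k : ι} (hi : b.IsPos i) (hk : P.root k = -P.root i) :
    ¬ b.IsPos k := by
  let := P.indexNeg
  have h : k = -i := P.root.injective (by simp [hk])
  rw [h, RootPairing.Base.IsPos.neg_iff_not, not_not]
  exact hi

variable [P.IsRootSystem]

theorem exists_nat_repr_of_mem_closure {x : V}
    (hx : x ∈ AddSubmonoid.closure (P.root '' (b.support : Set ι))) (j : b.support) :
    ∃ n : ℕ, b.toWeightBasis.repr x j = n := by
  classical
  induction hx using AddSubmonoid.closure_induction with
  | mem x hx =>
    obtain ⟨k, hk, rfl⟩ := hx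
    refine ⟨if (⟨k, hk⟩ : b.support) = j then 1 else 0, ?_⟩
    rw [b.toWeightBasis_repr_root ⟨k, hk⟩, Finsupp.single_apply]
    simp
  | zero => exact ⟨0, by simp⟩
  | add x y _ _ hx hy =>
    obtain ⟨m, hm⟩ := hx
    obtain ⟨n, hn⟩ := hy
    exact ⟨m + n, by simp [hm, hn]⟩

theorem repr_nonneg_of_mem_closure {x : V}
    (hx : x ∈ AddSubmonoid.closure (P.root '' (b.support : Set ι))) (j : b.support) :
    0 ≤ b.toWeightBasis.repr x j := by
  obtain ⟨n, hn⟩ := exists_nat_repr_of_mem_closure hx j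
  rw [hn]
  exact n.cast_nonneg

theorem apply_eq_sum_repr {M : Type*} [AddCommGroup M] [Module ℝ M] (f : V →ₗ[ℝ] M) (x : V) :
    f x = ∑ j : b.support, b.toWeightBasis.repr x j • f (P.root j) := by
  conv_lhs => rw [← b.toWeightBasis.sum_repr x]
  simp

theorem pairing_apply_eq_sum_repr (x : V) (v : V') :
    P.toLinearMap x v = ∑ j : b.support, b.toWeightBasis.repr x j * P.toLinearMap (P.root j) v := by
  simpa using apply_eq_sum_repr (b := b) (P.toLinearMap.flip v) x

theorem repr_root_self (j : b.support) : b.toWeightBasis.repr (P.root j) j = 1 := by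
  simp

theorem repr_root_of_ne {i j : b.support} (h : i ≠ j) : b.toWeightBasis.repr (P.root i) j = 0 := by
  rw [RootPairing.Base.toWeightBasis_repr_root, Finsupp.single_eq_of_ne h.symm]

variable [Finite ι] [P.IsCrystallographic]

theorem repr_nonneg_of_isPos {i : ι} (hi : b.IsPos i) (j : b.support) :
    0 ≤ b.toWeightBasis.repr (P.root i) j :=
  repr_nonneg_of_mem_closure (root_mem_closure_of_isPos hi) j

theorem repr_nonpos_of_not_isPos {i : ι} (hi : ¬ b.IsPos i) (j : b.support) :
    b.toWeightBasis.repr (P.root i) j ≤ 0 := by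
  obtain ⟨k, hk, hki⟩ := exists_isPos_neg hi
  have := repr_nonneg_of_isPos hk j
  rw [hki] at this
  simpa using this

theorem isPos_of_repr_pos {i : ι} {j : b.support} (h : 0 < b.toWeightBasis.repr (P.root i) j) :
    b.IsPos i := by
  by_contra hi
  exact (repr_nonpos_of_not_isPos hi j).not_gt h

theorem not_isPos_of_repr_nonpos {i : ι} (h : ∀ j, b.toWeightBasis.repr (P.root i) j ≤ 0) :
    ¬ b.IsPos i := by
  intro hi
  refine P.ne_zero i (b.toWeightBasis.repr.map_eq_zero_iff.mp ?_)
  ext j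
  exact le_antisymm (h j) (repr_nonneg_of_isPos hi j)

end Coordinates

/-! ## Existence of the highest root -/

section HighestRoot

variable [Finite ι] [P.IsRootSystem] [P.IsCrystallographic]

/-- A positive root to which no positive root can be added. -/
def IsMaximalRoot (b : P.Base) (i : ι) : Prop :=
  b.IsPos i ∧ ∀ l, b.IsPos l → P.root i + P.root l ∉ range P.root

omit [P.IsRootSystem] in
-- Among the positive roots above $a$, one of greatest height is maximal, since adding a positive
-- root raises the height.
theorem exists_isMaximalRoot {a : ι} (ha : b.IsPos a) :
    ∃ i, IsMaximalRoot b i ∧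
      P.root i - P.root a ∈ AddSubmonoid.closure (P.root '' (b.support : Set ι)) := by
  obtain ⟨i, ⟨hi, hia⟩, hmax⟩ := Set.exists_max_image
    {i | b.IsPos i ∧ P.root i - P.root a ∈ AddSubmonoid.closure (P.root '' (b.support : Set ι))}
    b.height (Set.toFinite _) ⟨a, ha, by simp⟩
  refine ⟨i, ⟨hi, ?_⟩, hia⟩
  rintro l hl ⟨k, hk⟩
  have hk' : b.height k ≤ b.height i := by
    refine hmax k ⟨hi.add hl hk, ?_⟩
    rw [hk, add_sub_right_comm]
    exact add_mem hia (root_mem_closure_of_isPos hl)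
  rw [b.height_add hk] at hk'
  rw [RootPairing.Base.isPos_iff] at hl
  omega

omit [P.IsRootSystem] in
theorem IsMaximalRoot.pairing_nonneg {i : ι} (h : IsMaximalRoot b i) (j : b.support) :
    0 ≤ P.pairingIn ℤ i j := by
  by_contra! hlt
  have hj := RootPairing.Base.isPos_of_mem_support j.2
  exact h.2 j hj (P.root_add_root_mem_of_pairingIn_neg hlt
    fun hij => not_isPos_of_root_eq_neg hj hij h.1)

omit [P.IsRootSystem] in
theorem IsMaximalRoot.pairing_nonneg' {i : ι} (h : IsMaximalRoot b i) (j : b.support) :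
    0 ≤ P.pairingIn ℤ j i := by
  have := h.pairing_nonneg j
  contrapose! this
  exact (P.pairingIn_lt_zero_iff ℤ).mp this

omit [Finite ι] [P.IsCrystallographic] in
theorem pairing_eq_sum_repr (i k : ι) :
    P.pairing i k = ∑ j : b.support, b.toWeightBasis.repr (P.root i) j * P.pairing j k :=
  pairing_apply_eq_sum_repr _ _

variable [P.IsReduced] [P.IsIrreducible]

/-- The support spreads along the connected Dynkin diagram: if $\alpha_l$ occurs and a neighbour
$\alpha_m$ does not, every term of the pairing with $\alpha_m^\vee$ is nonpositive and one is
negative, against dominance. -/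
theorem IsMaximalRoot.repr_pos {i : ι} (h : IsMaximalRoot b i) (j : b.support) :
    0 < b.toWeightBasis.repr (P.root i) j := by
  obtain ⟨k, hk⟩ : ∃ k, 0 < b.toWeightBasis.repr (P.root i) k := by
    by_contra! hk
    exact not_isPos_of_repr_nonpos hk h.1
  refine b.induction_on_cartanMatrix (fun j => 0 < b.toWeightBasis.repr (P.root i) j) hk ?_
  intro l m hl hml
  by_contra! hm
  have hm0 := le_antisymm hm (repr_nonneg_of_isPos h.1 m)
  have hlm : l ≠ m := by
    rintro rfl
    exact hl.not_ge hm
  have hnonpos : ∀ k : b.support, k ≠ m → P.pairing k m ≤ 0 := by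
    intro k hkm
    rw [← P.algebraMap_pairingIn ℤ]
    have := b.pairingIn_le_zero_of_ne (fun h => hkm (Subtype.ext h)) k.2 m.2
    simpa using this
  have hlt : P.pairing l m < 0 := by
    refine lt_of_le_of_ne (hnonpos l hlm) fun h0 => hml ?_
    have : P.pairing m l = 0 := by rwa [P.pairing_eq_zero_iff]
    rw [← P.algebraMap_pairingIn ℤ] at this
    simpa [RootPairing.Base.cartanMatrix, RootPairing.Base.cartanMatrixIn] using this
  have hsum : P.pairing i m < 0 := by
    rw [pairing_eq_sum_repr (b := b)]
    refine Finset.sum_neg' (fun k _ => ?_) ⟨l, Finset.mem_univ _, mul_neg_of_pos_of_neg hl hlt⟩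
    by_cases hkm : k = m
    · rw [hkm, hm0, zero_mul]
    · exact mul_nonpos_of_nonneg_of_nonpos (repr_nonneg_of_isPos h.1 k) (hnonpos k hkm)
  have := h.pairing_nonneg m
  rw [← P.algebraMap_pairingIn ℤ] at hsum
  simp only [algebraMap_int_eq, eq_intCast, Int.cast_lt_zero] at hsum
  omega

/-- One root has full support and the other is dominant and nonzero, so they pair positively. If
they differ, their difference is a root, and it or its negative can be added to one of them. -/
theorem IsMaximalRoot.eq {i k : ι} (hi : IsMaximalRoot b i) (hk : IsMaximalRoot b k) : i = k := by
  by_contra hik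
  obtain ⟨m, hm, hmk⟩ := hk.1.exists_mem_support_pos_pairingIn
  have hpos : 0 < P.pairing i k := by
    rw [pairing_eq_sum_repr (b := b)]
    refine Finset.sum_pos' (fun j _ => mul_nonneg (hi.repr_pos j).le ?_)
      ⟨⟨m, hm⟩, Finset.mem_univ _, mul_pos (hi.repr_pos _) ?_⟩
    · rw [← P.algebraMap_pairingIn ℤ]
      simpa using hk.pairing_nonneg' j
    · rw [← P.algebraMap_pairingIn ℤ]
      simpa using hmk
  rw [← P.algebraMap_pairingIn ℤ] at hpos
  simp only [algebraMap_int_eq, eq_intCast, Int.cast_pos] at hpos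
  obtain ⟨l, hl⟩ := P.root_sub_root_mem_of_pairingIn_pos hpos hik
  by_cases hlp : b.IsPos l
  · exact hk.2 l hlp ⟨i, by rw [hl]; abel⟩
  · obtain ⟨l', hl', hll⟩ := exists_isPos_neg hlp
    exact hi.2 l' hl' ⟨k, by rw [hll, hl]; abel⟩

variable (b)

theorem exists_isHighestRoot : ∃ x, IsHighestRoot b x := by
  have : Nontrivial V := IsIrreducible.nontrivial P
  have : Nonempty ι := by
    by_contra! h
    have := IsRootSystem.span_root_eq_top (P := P)
    rw [range_eq_empty, Submodule.span_empty] at this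
    exact bot_ne_top this
  obtain ⟨a, ha⟩ := b.support_nonempty
  obtain ⟨i, hi, -⟩ := exists_isMaximalRoot (RootPairing.Base.isPos_of_mem_support ha)
  refine ⟨P.root i, ⟨i, rfl⟩, fun k => ?_⟩
  by_cases hk : b.IsPos k
  · obtain ⟨l, hl, hlk⟩ := exists_isMaximalRoot hk
    rwa [hi.eq hl]
  · obtain ⟨k', hk', hkk⟩ := exists_isPos_neg hk
    rw [sub_eq_add_neg, ← hkk]
    exact add_mem (root_mem_closure_of_isPos hi.1) (root_mem_closure_of_isPos hk')

theorem isHighestRoot_highestRoot : IsHighestRoot b (highestRoot b) :=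
  Classical.epsilon_spec (exists_isHighestRoot b)

theorem exists_root_eq_highestRoot : ∃ i, b.IsPos i ∧ P.root i = highestRoot b := by
  obtain ⟨⟨i, hi⟩, h⟩ := isHighestRoot_highestRoot b
  refine ⟨i, ?_, hi⟩
  by_contra hn
  obtain ⟨k, hk, hki⟩ := exists_isPos_neg hn
  refine not_isPos_of_repr_nonpos (fun j => ?_) hk
  have h1 := repr_nonneg_of_mem_closure (h k) j
  have h2 := repr_nonpos_of_not_isPos hn j
  rw [← hi] at h1
  simp only [map_sub, Finsupp.coe_sub, Pi.sub_apply] at h1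
  linarith

theorem repr_root_le_highestCoeff (i : ι) (j : b.support) :
    b.toWeightBasis.repr (P.root i) j ≤ highestCoeff b j := by
  have := repr_nonneg_of_mem_closure ((isHighestRoot_highestRoot b).2 i) j
  simpa [highestCoeff] using this

theorem one_le_highestCoeff (j : b.support) : 1 ≤ highestCoeff b j := by
  simpa using repr_root_le_highestCoeff b j j

end HighestRoot

/-! ## The action of the Weyl group on the roots -/

section Lift

variable (P) in
/-- The linear map `w` permutes the coroots by `σ`, and its contragredient `A` permutes the roots
in the same way. -/
structure IsLift (w : V' ≃ₗ[ℝ] V') (σ : Equiv.Perm ι) (A : V ≃ₗ[ℝ] V) : Prop where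
  coroot : ∀ i, P.coroot (σ i) = w (P.coroot i)
  root : ∀ i, P.root (σ i) = A (P.root i)
  pairing : ∀ x v, P.toLinearMap (A x) (w v) = P.toLinearMap x v

namespace IsLift

variable {w u : V' ≃ₗ[ℝ] V'} {σ τ : Equiv.Perm ι} {A B : V ≃ₗ[ℝ] V}

theorem one : IsLift P 1 1 1 := ⟨fun _ => rfl, fun _ => rfl, fun _ _ => rfl⟩

theorem mul (h : IsLift P w σ A) (h' : IsLift P u τ B) : IsLift P (w * u) (σ * τ) (A * B) where
  coroot i := by simp [h.coroot, h'.coroot]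
  root i := by simp [h.root, h'.root]
  pairing x v := by simp [h.pairing, h'.pairing]

theorem inv (h : IsLift P w σ A) : IsLift P w⁻¹ σ⁻¹ A⁻¹ where
  coroot i := by
    apply w.injective
    rw [← h.coroot]
    simp
  root i := by
    apply A.injective
    rw [← h.root]
    simp
  pairing x v := by
    rw [← h.pairing]
    simp

theorem coreflection (i : ι) :
    IsLift P (P.coreflection i) (P.reflectionPerm i) (P.reflection i) where
  coroot k := by simp
  root k := by simp
  pairing x v := by
    simp only [RootPairing.reflection_apply, RootPairing.coreflection_apply, map_sub, map_smul,
      LinearMap.sub_apply, LinearMap.smul_apply, smul_eq_mul, RootPairing.root_coroot_two,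
      RootPairing.root', RootPairing.coroot', LinearMap.flip_apply]
    ring

/-- Conjugating a reflection by an element of the Weyl group. -/
theorem mul_coreflection (h : IsLift P w σ A) (i : ι) :
    w * P.coreflection i = P.coreflection (σ i) * w := by
  ext v
  simp [RootPairing.coreflection_apply, RootPairing.root', h.coroot, h.root, h.pairing]

theorem pairing_apply (h : IsLift P w σ A) (i : ι) (v : V') :
    P.toLinearMap (P.root i) (w v) = P.toLinearMap (P.root (σ⁻¹ i)) v := by
  rw [← h.pairing (P.root (σ⁻¹ i)), ← h.root]
  simp

end IsLift

/-- The reflection in $\alpha_k$ changes only the $k$-th simple coordinate, so coordinates outside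
$K$ are invariants. -/
theorem exists_isLift_of_mem_parabolic [P.IsRootSystem] {K : Set b.support} {w : V' ≃ₗ[ℝ] V'}
    (hw : w ∈ parabolic b K) :
    ∃ σ A, IsLift P w σ A ∧
      ∀ j ∉ K, ∀ x, b.toWeightBasis.repr (A x) j = b.toWeightBasis.repr x j := by
  have hgen : ∀ k ∈ K, ∀ j ∉ K, ∀ x,
      b.toWeightBasis.repr (P.reflection k x) j = b.toWeightBasis.repr x j := by
    intro k hk j hj x
    have hkj : k ≠ j := fun h => hj (h ▸ hk)
    simp [RootPairing.reflection_apply, -RootPairing.Base.toWeightBasis_repr_root,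
      repr_root_of_ne hkj]
  induction hw using Subgroup.closure_induction'' with
  | mem w hw =>
    obtain ⟨k, hk, rfl⟩ := hw
    exact ⟨_, _, IsLift.coreflection _, hgen k hk⟩
  | inv_mem w hw =>
    obtain ⟨k, hk, rfl⟩ := hw
    exact ⟨_, _, IsLift.coreflection _, hgen k hk⟩
  | one => exact ⟨_, _, IsLift.one, fun _ _ _ => rfl⟩
  | mul x y _ _ hx hy =>
    obtain ⟨σ, A, h, hA⟩ := hx
    obtain ⟨τ, B, h', hB⟩ := hy
    exact ⟨_, _, h.mul h', fun j hj x => (hA j hj _).trans (hB j hj x)⟩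

theorem parabolic_le_weyl (K : Set b.support) : parabolic b K ≤ weyl b :=
  Subgroup.closure_mono (image_mono (subset_univ K))

theorem exists_isLift [P.IsRootSystem] {w : V' ≃ₗ[ℝ] V'} (hw : w ∈ weyl b) :
    ∃ σ A, IsLift P w σ A := by
  obtain ⟨σ, A, h, -⟩ := exists_isLift_of_mem_parabolic hw
  exact ⟨σ, A, h⟩

end Lift

/-! ## The exchange condition -/

section Exchange

variable (b) in
/-- The product of simple reflections given by a word. -/
def wordProd (l : List b.support) : V' ≃ₗ[ℝ] V' :=
  (l.map fun j : b.support => P.coreflection j).prod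

variable (b) in
/-- The permutation of the roots given by a word in the simple reflections. -/
def wordPerm (l : List b.support) : Equiv.Perm ι :=
  (l.map fun j : b.support => P.reflectionPerm j).prod

theorem isLift_word (l : List b.support) : ∃ A, IsLift P (wordProd b l) (wordPerm b l) A := by
  induction l with
  | nil => exact ⟨1, IsLift.one⟩
  | cons k t ih =>
    obtain ⟨A, h⟩ := ih
    exact ⟨P.reflection k * A, by simpa [wordProd, wordPerm] using (IsLift.coreflection _).mul h⟩

theorem exists_word_of_mem_weyl {w : V' ≃ₗ[ℝ] V'} (hw : w ∈ weyl b) : ∃ l, w = wordProd b l := by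
  induction hw using Subgroup.closure_induction'' with
  | mem w hw =>
    obtain ⟨k, -, rfl⟩ := hw
    exact ⟨[k], by simp [wordProd]⟩
  | inv_mem w hw =>
    obtain ⟨k, -, rfl⟩ := hw
    exact ⟨[k], by simp [wordProd]⟩
  | one => exact ⟨[], rfl⟩
  | mul x y _ _ hx hy =>
    obtain ⟨l, rfl⟩ := hx
    obtain ⟨m, rfl⟩ := hy
    exact ⟨l ++ m, by simp [wordProd]⟩

variable [Finite ι] [P.IsCrystallographic] [P.IsReduced]

/-- The exchange condition: the deleted letter is the one, reading from the right, at which the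
image of $\alpha_i$ turns negative. -/
theorem exists_word_mul_coreflection (l : List b.support) (i : b.support)
    (h : ¬ b.IsPos (wordPerm b l i)) :
    ∃ l', l'.length + 1 = l.length ∧ wordProd b l' = wordProd b l * P.coreflection i := by
  induction l with
  | nil => exact absurd (RootPairing.Base.isPos_of_mem_support i.2) h
  | cons k t ih =>
    by_cases ht : b.IsPos (wordPerm b t i)
    · refine ⟨t, rfl, ?_⟩
      obtain ⟨A, hA⟩ := isLift_word t
      -- A simple reflection $s_k$ makes only one positive root negative, namely $\alpha_k$; so
      -- $t\alpha_i=\alpha_k$ and $s_k t s_i=s_k s_k t=t$.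
      have hk : wordPerm b t i = k := by
        by_contra hne
        refine h ?_
        have := ht.reflectionPerm k.2 hne
        simpa [wordPerm] using this
      have hcons : wordProd b (k :: t) = P.coreflection k * wordProd b t := by simp [wordProd]
      rw [hcons, mul_assoc, hA.mul_coreflection, hk, ← mul_assoc]
      ext v
      simp
    · obtain ⟨t', hlen, hprod⟩ := ih ht
      refine ⟨k :: t', by simp [← hlen], ?_⟩
      simp only [wordProd, List.map_cons, List.prod_cons, mul_assoc] at hprod ⊢
      rw [hprod]

/-- An element of the Weyl group that keeps the simple roots positive is trivial. -/
theorem eq_one_of_forall_isPos {w : V' ≃ₗ[ℝ] V'} (hw : w ∈ weyl b) {σ : Equiv.Perm ι}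
    (hσ : ∀ i, P.coroot (σ i) = w (P.coroot i)) (hpos : ∀ i ∈ b.support, b.IsPos (σ i)) :
    w = 1 := by
  classical
  have hex : ∃ n, ∃ l : List b.support, l.length = n ∧ w = wordProd b l := by
    obtain ⟨l, hl⟩ := exists_word_of_mem_weyl hw
    exact ⟨_, l, rfl, hl⟩
  obtain ⟨l, hlen, hl⟩ := Nat.find_spec hex
  rcases List.eq_nil_or_concat l with rfl | ⟨l, i, rfl⟩
  · exact hl
  exfalso
  have hw' : w = wordProd b l * P.coreflection i := by simp [hl, wordProd]
  obtain ⟨A, hA⟩ := isLift_word l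
  -- In a shortest word ending in $i$, the prefix sends $\alpha_i$ to $-w\alpha_i$, which is
  -- negative, and exchange yields a shorter word for $w$.
  have hneg : ¬ b.IsPos (wordPerm b l i) := by
    have hi : P.root (σ i) = - P.root (wordPerm b l i) := by
      have h1 : σ i = wordPerm b l (P.reflectionPerm i i) := by
        apply P.coroot.injective
        rw [hσ, hw', hA.coroot]
        simp
      rw [h1, hA.root, hA.root]
      simp
    refine not_isPos_of_root_eq_neg (hpos i i.2) ?_
    rw [hi, neg_neg]
  obtain ⟨l', hl', hprod⟩ := exists_word_mul_coreflection l i hneg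
  refine Nat.find_min hex (m := l'.length) ?_ ⟨l', rfl, by rw [hprod, hw']⟩
  rw [← hlen]
  simp [← hl']

end Exchange

/-! ## Longest elements -/

section Longest

variable [Finite ι]

theorem longest_mem (K : Set b.support) : longest b K ∈ parabolic b K :=
  (exists_longest b (parabolic b K)).choose_spec.1

theorem length_le_length_longest {K : Set b.support} {w : V' ≃ₗ[ℝ] V'} (hw : w ∈ parabolic b K) :
    length b w ≤ length b (longest b K) :=
  (exists_longest b (parabolic b K)).choose_spec.2 w hw

omit [Finite ι] in
theorem IsLift.length_eq {w : V' ≃ₗ[ℝ] V'} {σ : Equiv.Perm ι} {A : V ≃ₗ[ℝ] V}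
    (h : IsLift P w σ A) : length b w = Set.ncard {i | b.IsPos i ∧ ¬ b.IsPos (σ i)} := by
  unfold length
  congr 1
  ext i
  refine and_congr_right fun _ => ⟨?_, fun hi => ⟨σ i, hi, h.coroot i⟩⟩
  rintro ⟨k, hk, hki⟩
  rw [← h.coroot] at hki
  rwa [← P.coroot.injective hki]

variable [P.IsRootSystem] [P.IsCrystallographic] [P.IsReduced]

omit [P.IsRootSystem] in
/-- The longest element of a parabolic subgroup makes its simple roots negative. -/
theorem IsLift.not_isPos_of_longest {K : Set b.support} {σ : Equiv.Perm ι} {A : V ≃ₗ[ℝ] V}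
    (h : IsLift P (longest b K) σ A) {k : b.support} (hk : k ∈ K) : ¬ b.IsPos (σ k) := by
  intro hpos
  have hmem : longest b K * P.coreflection k ∈ parabolic b K :=
    mul_mem (longest_mem K) (Subgroup.subset_closure ⟨k, hk, rfl⟩)
  have hle := length_le_length_longest hmem
  rw [h.length_eq, (h.mul (IsLift.coreflection (k : ι))).length_eq] at hle
  have hkpos := RootPairing.Base.isPos_of_mem_support k.2
  have hneg : ¬ b.IsPos (σ (P.reflectionPerm k k)) := by
    refine not_isPos_of_root_eq_neg hpos ?_
    rw [h.root, h.root]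
    simp
  have hnot : (k : ι) ∉ P.reflectionPerm k '' {i | b.IsPos i ∧ ¬ b.IsPos (σ i)} := by
    rintro ⟨i, ⟨hi, -⟩, hik⟩
    have : i = P.reflectionPerm k k := by
      simpa using congrArg (P.reflectionPerm k) hik
    refine not_isPos_of_root_eq_neg hkpos (k := i) ?_ hi
    rw [this]
    simp
  -- If $w\alpha_k$ were positive, $s_k$ would carry the inversions of $w$ to inversions of $ws_k$,
  -- and $\alpha_k$ would be an additional one: $ws_k$ would be longer.
  have hsub : insert (k : ι) (P.reflectionPerm k '' {i | b.IsPos i ∧ ¬ b.IsPos (σ i)}) ⊆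
      {i | b.IsPos i ∧ ¬ b.IsPos ((σ * P.reflectionPerm k) i)} := by
    refine insert_subset ⟨hkpos, hneg⟩ ?_
    rintro _ ⟨i, ⟨hi, hi'⟩, rfl⟩
    refine ⟨hi.reflectionPerm k.2 ?_, by simpa using hi'⟩
    rintro rfl
    exact hi' hpos
  have hcard := Set.ncard_le_ncard hsub (Set.toFinite _)
  rw [Set.ncard_insert_of_notMem hnot (Set.toFinite _),
    Set.ncard_image_of_injective _ (P.reflectionPerm k).injective] at hcard
  omega

theorem IsLift.not_isPos_of_longest_of_isPos {K : Set b.support} {σ : Equiv.Perm ι}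
    {A : V ≃ₗ[ℝ] V} (h : IsLift P (longest b K) σ A) {i : ι} (hi : b.IsPos i)
    (hiK : ∀ j ∉ K, b.toWeightBasis.repr (P.root i) j = 0) : ¬ b.IsPos (σ i) := by
  refine not_isPos_of_repr_nonpos fun j => ?_
  have hsum := apply_eq_sum_repr (b := b)
    (b.toWeightBasis.coord j ∘ₗ (A : V →ₗ[ℝ] V)) (P.root i)
  simp only [LinearMap.comp_apply, LinearEquiv.coe_coe, Module.Basis.coord_apply,
    ← h.root, smul_eq_mul] at hsum
  rw [hsum]
  refine Finset.sum_nonpos fun k _ => ?_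
  by_cases hk : k ∈ K
  · exact mul_nonpos_of_nonneg_of_nonpos (repr_nonneg_of_isPos hi k)
      (repr_nonpos_of_not_isPos (h.not_isPos_of_longest hk) j)
  · rw [hiK k hk, zero_mul]

theorem exists_isLift_longest (K : Set b.support) :
    ∃ σ A, IsLift P (longest b K) σ A ∧
      (∀ j ∉ K, ∀ x, b.toWeightBasis.repr (A x) j = b.toWeightBasis.repr x j) ∧
      ∀ i, b.IsPos i → (∀ j ∉ K, b.toWeightBasis.repr (P.root i) j = 0) → ¬ b.IsPos (σ i) := by
  obtain ⟨σ, A, h, hA⟩ := exists_isLift_of_mem_parabolic (longest_mem (b := b) K)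
  exact ⟨σ, A, h, hA, fun i hi hiK => h.not_isPos_of_longest_of_isPos hi hiK⟩

end Longest

/-! ## The elements `w_0^j w_0` -/

section Minuscule

variable [Finite ι] [P.IsRootSystem] [P.IsCrystallographic] [P.IsReduced]

variable (b) in
/-- The signs of the roots `u⁻¹ α` for positive `α` and `u = w_0^j w_0`. -/
theorem exists_isLift_longest_mul_longest (j : b.support) :
    ∃ σ A, IsLift P (longest b {j}ᶜ * longest b univ) σ A ∧
      ∀ i, b.IsPos i → (b.IsPos (σ⁻¹ i) ↔ b.toWeightBasis.repr (P.root i) j = 0) := by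
  obtain ⟨σ, A, h, hA, hneg⟩ := exists_isLift_longest (b := b) ({j}ᶜ : Set b.support)
  obtain ⟨τ, B, h', -, hneg'⟩ := exists_isLift_longest (b := b) univ
  replace hneg' : ∀ i, b.IsPos i → ¬ b.IsPos (τ i) := fun i hi =>
    hneg' i hi fun j hj => absurd (mem_univ j) hj
  have hτ : ∀ i, b.IsPos (τ⁻¹ i) ↔ ¬ b.IsPos i := by
    intro i
    refine ⟨fun hi => by simpa using hneg' _ hi, fun hi => ?_⟩
    by_contra hn
    obtain ⟨k, hk, hki⟩ := exists_isPos_neg hi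
    obtain ⟨l, hl, hli⟩ := exists_isPos_neg hn
    have hlk : τ l = k := P.root.injective <| by
      rw [h'.root, hli, map_neg, ← h'.root, hki]
      simp
    exact hneg' l hl (hlk ▸ hk)
  refine ⟨_, _, h.mul h', fun i hi => ?_⟩
  rw [mul_inv_rev, Equiv.Perm.mul_apply, hτ]
  -- The factor $w_0^j$ preserves the $j$-th coordinate. If this is positive the root stays
  -- positive; if it is zero the root lies in the parabolic subsystem and changes sign. The factor
  -- $w_0$ then reverses all signs.
  have hrepr : b.toWeightBasis.repr (P.root (σ⁻¹ i)) j = b.toWeightBasis.repr (P.root i) j := by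
    rw [← hA j (by simp), ← h.root]
    simp
  constructor
  · intro hn
    by_contra h0
    refine hn (isPos_of_repr_pos (j := j) ?_)
    rw [hrepr]
    exact lt_of_le_of_ne (repr_nonneg_of_isPos hi j) (Ne.symm h0)
  · intro h0 hp
    refine hneg _ hp ?_ (by simpa using hi)
    intro k hk
    obtain rfl : k = j := by simpa using hk
    rw [hrepr, h0]

variable [P.IsIrreducible]

omit [P.IsReduced] [P.IsIrreducible] in
theorem exists_nat_repr_of_isPos {i : ι} (hi : b.IsPos i) (j : b.support) :
    ∃ n : ℕ, b.toWeightBasis.repr (P.root i) j = n :=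
  exists_nat_repr_of_mem_closure (root_mem_closure_of_isPos hi) j

theorem repr_eq_zero_or_one {j : b.support} (hj : j ∈ minusculeIndices b) {i : ι}
    (hi : b.IsPos i) :
    b.toWeightBasis.repr (P.root i) j = 0 ∨ b.toWeightBasis.repr (P.root i) j = 1 := by
  obtain ⟨n, hn⟩ := exists_nat_repr_of_isPos hi j
  have hle := repr_root_le_highestCoeff b i j
  rw [show highestCoeff b j = 1 from hj, hn] at hle
  have : n ≤ 1 := by exact_mod_cast hle
  rw [hn]
  interval_cases n <;> simp

/-- The element `w_0^j w_0` sends the highest root to `-α_j`. -/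
theorem longest_mul_longest_highestRoot {j : b.support} (hj : j ∈ minusculeIndices b)
    {w : V' ≃ₗ[ℝ] V'} {σ : Equiv.Perm ι} {A : V ≃ₗ[ℝ] V} (h : IsLift P w σ A)
    (hσ : ∀ i, b.IsPos i → (b.IsPos (σ⁻¹ i) ↔ b.toWeightBasis.repr (P.root i) j = 0)) :
    A (highestRoot b) = -P.root j := by
  -- For minuscule $j$ the $j$-th coordinate of a positive root is $0$ or $1$, so the sign rule
  -- determines that of $u\alpha$, where $u=w_0^jw_0$.
  have hsign : ∀ i, b.IsPos i →
      (b.IsPos (σ i) ∧ b.toWeightBasis.repr (P.root (σ i)) j = 0) ∨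
      (¬ b.IsPos (σ i) ∧ b.toWeightBasis.repr (P.root (σ i)) j = -1) := by
    intro i hi
    by_cases hp : b.IsPos (σ i)
    · exact Or.inl ⟨hp, (hσ _ hp).mp (by simpa using hi)⟩
    · refine Or.inr ⟨hp, ?_⟩
      obtain ⟨k, hk, hki⟩ := exists_isPos_neg hp
      have hne : b.toWeightBasis.repr (P.root k) j ≠ 0 := by
        rw [Ne, ← hσ k hk]
        refine ExtAffineWeyl.not_isPos_of_root_eq_neg hi ?_
        rw [h.inv.root, hki, map_neg, ← h.inv.root]
        simp
      have := (repr_eq_zero_or_one hj hk).resolve_left hne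
      rw [hki] at this
      simp only [map_neg, Finsupp.coe_neg, Pi.neg_apply] at this
      linarith
  obtain ⟨i₀, hi₀, hroot⟩ := exists_root_eq_highestRoot b
  have hd : ¬ b.IsPos (σ⁻¹ j) := by
    rw [hσ j (RootPairing.Base.isPos_of_mem_support j.2), repr_root_self]
    exact one_ne_zero
  obtain ⟨d, -, hdj⟩ := exists_isPos_neg hd
  have hAd : A (P.root d) = -P.root j := by
    rw [hdj, map_neg, ← h.root]
    simp
  have hcl := (isHighestRoot_highestRoot b).2 d
  -- With $d=-u^{-1}\alpha_j$, write $\alpha_0-d=\sum c_k\alpha_k$ with $c_k\ge0$ and apply $u$: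
  -- $u\alpha_0+\alpha_j=\sum c_k\,u\alpha_k$.
  have hsum : ∀ l, b.toWeightBasis.repr (P.root (σ i₀)) l + b.toWeightBasis.repr (P.root j) l =
      ∑ k : b.support, b.toWeightBasis.repr (highestRoot b - P.root d) k *
        b.toWeightBasis.repr (P.root (σ k)) l := by
    intro l
    have := apply_eq_sum_repr (b := b) (b.toWeightBasis.coord l ∘ₗ (A : V →ₗ[ℝ] V))
      (highestRoot b - P.root d)
    simp only [LinearMap.comp_apply, LinearEquiv.coe_coe, Module.Basis.coord_apply, map_sub A,
      hAd, sub_neg_eq_add, ← hroot, ← h.root, smul_eq_mul] at this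
    rw [map_add, Finsupp.add_apply] at this
    rw [this, ← hroot]
  have hterm : ∀ k : b.support, b.toWeightBasis.repr (highestRoot b - P.root d) k *
      b.toWeightBasis.repr (P.root (σ k)) j ≤ 0 := by
    intro k
    refine mul_nonpos_of_nonneg_of_nonpos (repr_nonneg_of_mem_closure hcl k) ?_
    rcases hsign k (RootPairing.Base.isPos_of_mem_support k.2) with ⟨-, h0⟩ | ⟨-, h0⟩
    · exact h0.le
    · rw [h0]
      norm_num
  have hj' := hsum j
  rw [repr_root_self] at hj'
  have hle : ∑ k : b.support, b.toWeightBasis.repr (highestRoot b - P.root d) k *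
        b.toWeightBasis.repr (P.root (σ k)) j ≤ 0 := Finset.sum_nonpos fun k _ => hterm k
  rcases hsign i₀ hi₀ with ⟨-, h0⟩ | ⟨hneg, h0⟩
  · rw [h0] at hj'
    linarith
  -- In the $j$-th coordinate the right side is $\le0$ and the left is now $-1+1=0$, so $c_k=0$
  -- whenever $u\alpha_k$ is negative. The remaining $u\alpha_k$ are positive, which bounds the
  -- other coordinates of $u\alpha_0$ below by $0$.
  have hzero : ∀ k : b.support, b.toWeightBasis.repr (highestRoot b - P.root d) k *
      b.toWeightBasis.repr (P.root (σ k)) j = 0 := by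
    have := (Finset.sum_eq_zero_iff_of_nonpos (s := Finset.univ) fun k _ => hterm k).mp
      (by rw [← hj', h0]; norm_num)
    exact fun k => this k (Finset.mem_univ k)
  rw [← hroot, ← h.root]
  apply b.toWeightBasis.repr.injective
  ext l
  rw [map_neg, Finsupp.neg_apply]
  by_cases hl : j = l
  · subst hl
    rw [h0, repr_root_self]
  · rw [repr_root_of_ne hl, neg_zero]
    refine le_antisymm (repr_nonpos_of_not_isPos hneg l) ?_
    have := hsum l
    rw [repr_root_of_ne hl, add_zero] at this
    rw [this]
    refine Finset.sum_nonneg fun k _ => ?_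
    rcases hsign k (RootPairing.Base.isPos_of_mem_support k.2) with ⟨hp, -⟩ | ⟨-, h1⟩
    · exact mul_nonneg (repr_nonneg_of_mem_closure hcl k) (repr_nonneg_of_isPos hp l)
    · have := hzero k
      rw [h1] at this
      have : b.toWeightBasis.repr (highestRoot b - P.root d) k = 0 := by linarith
      rw [this, zero_mul]

end Minuscule

/-! ## The group `Ω` -/

section Omega

theorem inv_apply_self (g : V' ≃ᵃ[ℝ] V') (v : V') : g⁻¹ (g v) = v :=
  g.symm_apply_apply v

theorem apply_inv_self (g : V' ≃ᵃ[ℝ] V') (v : V') : g (g⁻¹ v) = v :=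
  g.apply_symm_apply v

theorem trans_mul_apply (x : V') (w : V' ≃ₗ[ℝ] V') (v : V') :
    (trans x * w.toAffineEquiv) v = x + w v := by
  simp [trans]

variable [P.IsRootSystem]

@[simp]
theorem pairing_coweight (x : V) (j : b.support) :
    P.toLinearMap x (fundamentalCoweight b j) = b.toWeightBasis.repr x j := by
  rw [fundamentalCoweight, LinearMap.apply_toPerfPair_flip, Module.Basis.coord_apply]

theorem ext_of_pairing {x y : V'}
    (h : ∀ k : b.support, P.toLinearMap (P.root k) x = P.toLinearMap (P.root k) y) : x = y := by
  apply P.toLinearMap.flip.toPerfPair.injective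
  refine b.toWeightBasis.ext fun k => ?_
  simpa using h k

theorem omegaElt_apply [Finite ι] (j : b.support) (v : V') :
    omegaElt b j v = fundamentalCoweight b j + (longest b {j}ᶜ * longest b univ) v :=
  trans_mul_apply _ _ v

theorem omegaElt_inv_apply [Finite ι] (j : b.support) (v : V') :
    (omegaElt b j)⁻¹ v = (longest b {j}ᶜ * longest b univ)⁻¹ (v - fundamentalCoweight b j) := by
  apply (omegaElt b j).injective
  rw [apply_inv_self, omegaElt_apply, ← LinearEquiv.mul_apply, mul_inv_cancel]
  simp

theorem omegaElt_zero [Finite ι] (j : b.support) : omegaElt b j 0 = fundamentalCoweight b j := by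
  rw [omegaElt_apply, map_zero, add_zero]

variable (b) in
/-- The open fundamental alcove. -/
def openAlcove : Set V' :=
  {v | ∀ i : ι, b.IsPos i → 0 < P.toLinearMap (P.root i) v ∧ P.toLinearMap (P.root i) v < 1}

omit [P.IsRootSystem] in
theorem openAlcove_subset : openAlcove b ⊆ alcove b :=
  fun _ hv i hi => ⟨(hv i hi).1.le, (hv i hi).2.le⟩

variable [Finite ι] [P.IsCrystallographic]

theorem fundamentalCoweight_mem (j : b.support) : fundamentalCoweight b j ∈ coweightLattice P := by
  intro i
  rw [pairing_coweight]
  by_cases hi : b.IsPos i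
  · obtain ⟨n, hn⟩ := exists_nat_repr_of_mem_closure (root_mem_closure_of_isPos hi) j
    exact ⟨n, by simpa using hn⟩
  · obtain ⟨k, hk, hki⟩ := exists_isPos_neg hi
    obtain ⟨n, hn⟩ := exists_nat_repr_of_mem_closure (root_mem_closure_of_isPos hk) j
    refine ⟨-n, ?_⟩
    rw [hki] at hn
    simp only [map_neg, Finsupp.coe_neg, Pi.neg_apply] at hn
    push_cast
    linarith

theorem omegaElt_mem_extAffineWeyl (j : b.support) : omegaElt b j ∈ extAffineWeyl b :=
  ⟨_, fundamentalCoweight_mem j, _, mul_mem (parabolic_le_weyl _ (longest_mem _))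
    (parabolic_le_weyl _ (longest_mem _)), rfl⟩

omit [Finite ι] in
/-- An element of the extended affine Weyl group that sends some point of the open alcove into the
closed alcove maps the alcove into itself. -/
theorem mapsTo_alcove {g : V' ≃ᵃ[ℝ] V'} (hg : g ∈ extAffineWeyl b) {v : V'}
    (hv : v ∈ openAlcove b) (hgv : g v ∈ alcove b) :
    MapsTo g (alcove b) (alcove b) ∧ g v ∈ openAlcove b := by
  obtain ⟨x, hx, w, hw, rfl⟩ := hg
  obtain ⟨σ, A, h⟩ := exists_isLift hw
  -- A positive root pulls back to $m\pm$ a positive root, $m$ an integer. Strict bounds at $v$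
  -- squeeze $m$ to $0$ for the sign $+$ and to $1$ for the sign $-$.
  have key : ∀ i, b.IsPos i → ∃ k, b.IsPos k ∧
      ((∀ y, P.toLinearMap (P.root i) (x + w y) = P.toLinearMap (P.root k) y) ∨
      ∀ y, P.toLinearMap (P.root i) (x + w y) = 1 - P.toLinearMap (P.root k) y) := by
    intro i hi
    obtain ⟨m, hm⟩ := hx i
    have hval := hgv i hi
    simp only [trans_mul_apply, map_add, hm, h.pairing_apply] at hval ⊢
    by_cases hk : b.IsPos (σ⁻¹ i)
    · refine ⟨_, hk, Or.inl fun y => ?_⟩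
      obtain ⟨h1, h2⟩ := hv _ hk
      have h3 : (-1 : ℝ) < m := by linarith
      have h4 : (m : ℝ) < 1 := by linarith
      have h3' : -1 < m := by exact_mod_cast h3
      have h4' : m < 1 := by exact_mod_cast h4
      obtain rfl : m = 0 := by omega
      simp
    · obtain ⟨k, hk, hki⟩ := exists_isPos_neg hk
      refine ⟨k, hk, Or.inr fun y => ?_⟩
      obtain ⟨h1, h2⟩ := hv _ hk
      simp only [hki, map_neg, LinearMap.neg_apply] at h1 h2 ⊢
      have h3 : (0 : ℝ) < m := by linarith
      have h4 : (m : ℝ) < 2 := by linarith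
      have h3' : 0 < m := by exact_mod_cast h3
      have h4' : m < 2 := by exact_mod_cast h4
      obtain rfl : m = 1 := by omega
      simp
  constructor
  · intro y hy i hi
    rw [trans_mul_apply]
    obtain ⟨k, hk, hk' | hk'⟩ := key i hi <;> rw [hk'] <;> have := hy k hk
    · exact this
    · constructor <;> linarith
  · intro i hi
    rw [trans_mul_apply]
    obtain ⟨k, hk, hk' | hk'⟩ := key i hi <;> rw [hk'] <;> have := hv k hk
    · exact this
    · constructor <;> linarith

omit [Finite ι] in
-- The image point is again in the open alcove, so the inverse maps the alcove into itself too.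
theorem mem_omega_of_apply_mem {g : V' ≃ᵃ[ℝ] V'} (hg : g ∈ extAffineWeyl b) {v : V'}
    (hv : v ∈ openAlcove b) (hgv : g v ∈ alcove b) : g ∈ omega b := by
  obtain ⟨hmaps, hopen⟩ := mapsTo_alcove hg hv hgv
  refine ⟨hg, hmaps.image_subset.antisymm fun y hy => ⟨g⁻¹ y, ?_, apply_inv_self g y⟩⟩
  refine (mapsTo_alcove (inv_mem hg) hopen ?_).1 hy
  rw [inv_apply_self]
  exact openAlcove_subset hv

omit [P.IsRootSystem] [Finite ι] in
theorem apply_mem_alcove {g : V' ≃ᵃ[ℝ] V'} (hg : g ∈ omega b) {v : V'} (hv : v ∈ alcove b) :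
    g v ∈ alcove b := by
  have h : g '' alcove b = alcove b := hg.2
  exact h.subset (mem_image_of_mem g hv)

variable [P.IsReduced] [P.IsIrreducible]

variable (b) in
theorem openAlcove_nonempty : (openAlcove b).Nonempty := by
  obtain ⟨i₀, hi₀, hroot⟩ := exists_root_eq_highestRoot b
  have hsum : ∀ i, b.IsPos i → 0 < ∑ j, b.toWeightBasis.repr (P.root i) j := by
    intro i hi
    obtain ⟨j, hj⟩ : ∃ j, 0 < b.toWeightBasis.repr (P.root i) j := by
      by_contra! hk
      exact not_isPos_of_repr_nonpos hk hi
    exact Finset.sum_pos' (fun k _ => repr_nonneg_of_isPos hi k) ⟨j, Finset.mem_univ j, hj⟩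
  set h : ℝ := ∑ j, highestCoeff b j with hh
  have hpos : 0 < h := by
    have := hsum i₀ hi₀
    rwa [hroot] at this
  -- The witness is $\sum_j\varpi_j^\vee$, which measures heights, divided by twice the height $h$
  -- of the highest root.
  refine ⟨(2 * h)⁻¹ • ∑ j, fundamentalCoweight b j, fun i hi => ?_⟩
  have hle : ∑ j, b.toWeightBasis.repr (P.root i) j ≤ h :=
    Finset.sum_le_sum fun j _ => repr_root_le_highestCoeff b i j
  simp only [map_smul, map_sum, pairing_coweight, smul_eq_mul]
  refine ⟨mul_pos (by positivity) (hsum i hi), ?_⟩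
  rw [inv_mul_lt_iff₀ (by positivity)]
  linarith

/-- The translation adds $1$ to exactly those positive roots whose pullback by $w_0^jw_0$ is
negative. -/
theorem omegaElt_mem_omega {j : b.support} (hj : j ∈ minusculeIndices b) :
    omegaElt b j ∈ omega b := by
  obtain ⟨v, hv⟩ := openAlcove_nonempty b
  refine mem_omega_of_apply_mem (omegaElt_mem_extAffineWeyl j) hv fun i hi => ?_
  obtain ⟨σ, A, h, hσ⟩ := exists_isLift_longest_mul_longest b j
  rw [omegaElt_apply, map_add, pairing_coweight, h.pairing_apply]
  by_cases hk : b.IsPos (σ⁻¹ i)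
  · rw [(hσ i hi).mp hk, zero_add]
    exact openAlcove_subset hv _ hk
  · rw [(repr_eq_zero_or_one hj hi).resolve_left (mt (hσ i hi).mpr hk)]
    obtain ⟨k, hk, hki⟩ := exists_isPos_neg hk
    have := hv k hk
    simp only [hki, map_neg, LinearMap.neg_apply] at this
    constructor <;> linarith

theorem pairing_highestRoot_omegaElt_inv {j : b.support} (hj : j ∈ minusculeIndices b) (v : V') :
    P.toLinearMap (highestRoot b) ((omegaElt b j)⁻¹ v) = 1 - P.toLinearMap (P.root j) v := by
  obtain ⟨σ, A, h, hσ⟩ := exists_isLift_longest_mul_longest b j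
  rw [omegaElt_inv_apply]
  conv_lhs => rw [← h.pairing, longest_mul_longest_highestRoot hj h hσ]
  rw [← LinearEquiv.mul_apply, mul_inv_cancel]
  simp [-RootPairing.Base.toWeightBasis_repr_root, repr_root_self]

omit [P.IsCrystallographic] [P.IsReduced] [P.IsIrreducible] in
theorem omegaElt_ne_one (j : b.support) : omegaElt b j ≠ 1 := by
  intro h
  have h0 := omegaElt_zero j
  rw [h, AffineEquiv.coe_one, id_eq] at h0
  have := pairing_coweight (P.root j) j
  rw [← h0, map_zero, repr_root_self] at this
  exact zero_ne_one this

omit [P.IsCrystallographic] [P.IsReduced] [P.IsIrreducible] in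
theorem omegaElt_injective : Function.Injective (omegaElt b) := by
  intro j k hjk
  by_contra hne
  have h0 := omegaElt_zero j
  rw [hjk, omegaElt_zero] at h0
  have := pairing_coweight (P.root j) j
  rw [← h0, pairing_coweight, repr_root_self, repr_root_of_ne hne] at this
  exact zero_ne_one this

theorem eq_one_of_mem_omega_of_apply_zero {g : V' ≃ᵃ[ℝ] V'} (hg : g ∈ omega b) (h0 : g 0 = 0) :
    g = 1 := by
  obtain ⟨v, hv⟩ := openAlcove_nonempty b
  have hgv := apply_mem_alcove hg (openAlcove_subset hv)
  obtain ⟨⟨x, hx, w, hw, rfl⟩, -⟩ := hg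
  obtain rfl : x = 0 := by simpa [trans_mul_apply] using h0
  obtain ⟨σ, A, h⟩ := exists_isLift hw
  -- If $w$ made $\alpha_i$ negative, the positive root $-w\alpha_i$ would take the value $-\langle
  -- v,\alpha_i\rangle<0$ at $wv$.
  obtain rfl := eq_one_of_forall_isPos hw h.coroot fun i hi => by
    by_contra hn
    obtain ⟨k, hk, hki⟩ := exists_isPos_neg hn
    have h1 := (hgv k hk).1
    have h2 := (hv i (RootPairing.Base.isPos_of_mem_support hi)).1
    rw [trans_mul_apply, zero_add, hki, map_neg, LinearMap.neg_apply, h.root, h.pairing] at h1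
    linarith
  ext v
  simp

omit [P.IsRootSystem] [Finite ι] [P.IsCrystallographic] [P.IsReduced] [P.IsIrreducible] in
variable (b) in
theorem zero_mem_alcove : (0 : V') ∈ alcove b := fun i _ => by simp

theorem exists_eq_omegaElt {g : V' ≃ᵃ[ℝ] V'} (hg : g ∈ omega b) (hg1 : g ≠ 1) :
    ∃ j ∈ minusculeIndices b, omegaElt b j = g := by
  have hx0 : g 0 ≠ 0 := fun h => hg1 (eq_one_of_mem_omega_of_apply_zero hg h)
  have halc := apply_mem_alcove hg (zero_mem_alcove b)
  have hlat : g 0 ∈ coweightLattice P := by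
    obtain ⟨⟨x, hx, w, hw, rfl⟩, -⟩ := hg
    simpa [trans_mul_apply] using hx
  set x := g 0
  have hval : ∀ k : b.support, P.toLinearMap (P.root k) x = 0 ∨
      P.toLinearMap (P.root k) x = 1 := by
    intro k
    obtain ⟨n, hn⟩ := hlat k
    have := halc k (RootPairing.Base.isPos_of_mem_support k.2)
    rw [hn] at this ⊢
    have h1 : 0 ≤ n := by exact_mod_cast this.1
    have h2 : n ≤ 1 := by exact_mod_cast this.2
    interval_cases n <;> simp
  obtain ⟨j, hj⟩ : ∃ j : b.support, P.toLinearMap (P.root j) x = 1 := by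
    by_contra! hne
    refine hx0 (ext_of_pairing (P := P) (b := b) fun k => ?_)
    rw [(hval k).resolve_right (hne k), map_zero]
  obtain ⟨i₀, hi₀, hroot⟩ := exists_root_eq_highestRoot b
  have hle := (halc i₀ hi₀).2
  have hnonneg : ∀ k : b.support, 0 ≤ highestCoeff b k * P.toLinearMap (P.root k) x := fun k =>
    mul_nonneg (zero_le_one.trans (one_le_highestCoeff b k))
      (halc k (RootPairing.Base.isPos_of_mem_support k.2)).1
  classical
  rw [hroot, pairing_apply_eq_sum_repr (b := b)] at hle
  have hsplit := Finset.add_sum_erase Finset.univ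
    (fun k : b.support => highestCoeff b k * P.toLinearMap (P.root k) x) (Finset.mem_univ j)
  have herase : 0 ≤ ∑ k ∈ Finset.univ.erase j,
      highestCoeff b k * P.toLinearMap (P.root k) x := Finset.sum_nonneg fun k _ => hnonneg k
  change ∑ k : b.support, highestCoeff b k * P.toLinearMap (P.root k) x ≤ 1 at hle
  have hone := one_le_highestCoeff b j
  -- All $n_k\ge1$, so $\langle x,\alpha_0\rangle\le1$ leaves room for a single nonzero coordinate,
  -- with $n_j=1$.
  rw [← hsplit, hj, mul_one] at hle
  have hJ : j ∈ minusculeIndices b := show highestCoeff b j = 1 by linarith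
  refine ⟨j, hJ, ?_⟩
  have hx : x = fundamentalCoweight b j := by
    refine ext_of_pairing (P := P) (b := b) fun k => ?_
    rw [pairing_coweight]
    by_cases hkj : k = j
    · rw [hkj, hj, repr_root_self]
    · rw [repr_root_of_ne hkj]
      refine (hval k).resolve_right fun h1 => ?_
      have := Finset.single_le_sum (fun k _ => hnonneg k)
        (Finset.mem_erase.mpr ⟨hkj, Finset.mem_univ k⟩)
      rw [h1, mul_one] at this
      linarith [one_le_highestCoeff b k]
  have : (omegaElt b j)⁻¹ * g = 1 := by
    refine eq_one_of_mem_omega_of_apply_zero (b := b)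
      (mul_mem (inv_mem (omegaElt_mem_omega hJ)) hg) ?_
    change (omegaElt b j)⁻¹ x = 0
    rw [omegaElt_inv_apply, hx, sub_self, map_zero]
  exact inv_mul_eq_one.mp this

theorem finite_omega : (omega b : Set (V' ≃ᵃ[ℝ] V')).Finite := by
  refine (((minusculeIndices b).toFinite.image (omegaElt b)).insert 1).subset fun g hg => ?_
  by_cases h : g = 1
  · exact Or.inl h
  · exact Or.inr (exists_eq_omegaElt hg h)

variable (b) in
theorem bijOn_omegaElt : BijOn (omegaElt b) (minusculeIndices b)
    ((omega b : Set (V' ≃ᵃ[ℝ] V')) \ {1}) :=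
  ⟨fun j hj => ⟨omegaElt_mem_omega hj, omegaElt_ne_one j⟩, omegaElt_injective.injOn,
    fun _ hg => exists_eq_omegaElt hg.1 hg.2⟩

end Omega

/-! ## The polytope as a fundamental domain -/

section Polytope

variable [Finite ι] [P.IsRootSystem] [P.IsCrystallographic] [P.IsReduced] [P.IsIrreducible]

/-- The points of `F_{P^∨}` are those at which the highest root is minimal on the `Ω`-orbit. -/
theorem mem_fundPolytope_iff {v : V'} : v ∈ fundPolytope b ↔ v ∈ alcove b ∧ ∀ g ∈ omega b,
    P.toLinearMap (highestRoot b) v ≤ P.toLinearMap (highestRoot b) (g v) := by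
  refine and_congr_right fun _ => ⟨fun h g hg => ?_, fun h j hj => ?_⟩
  -- It is $g^{-1}$ that is written as $\omega_j$, because the key identity concerns
  -- $\omega_j^{-1}$.
  · by_cases h1 : g = 1
    · rw [h1, AffineEquiv.coe_one, id_eq]
    · obtain ⟨j, hj, hjg⟩ := exists_eq_omegaElt (inv_mem hg) (inv_ne_one.mpr h1)
      have := h j hj
      rw [← inv_inv g, ← hjg, pairing_highestRoot_omegaElt_inv hj]
      rw [map_add, LinearMap.add_apply] at this
      linarith
  · have := h _ (inv_mem (omegaElt_mem_omega hj))
    rw [pairing_highestRoot_omegaElt_inv hj] at this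
    rw [map_add, LinearMap.add_apply]
    linarith

theorem exists_apply_mem_fundPolytope {v : V'} (hv : v ∈ alcove b) :
    ∃ g ∈ omega b, g v ∈ fundPolytope b := by
  obtain ⟨g, hg, hmin⟩ := Set.exists_min_image (omega b : Set (V' ≃ᵃ[ℝ] V'))
    (fun g => P.toLinearMap (highestRoot b) (g v)) finite_omega ⟨1, one_mem _⟩
  exact ⟨g, hg, mem_fundPolytope_iff.mpr ⟨apply_mem_alcove hg hv,
    fun g' hg' => hmin (g' * g) (mul_mem hg' hg)⟩⟩

/-- Equality on the wall means that $\alpha_0$ takes the same value at $v$ and $\omega_j^{-1}v$;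
minimality on the orbit then passes between them. -/
theorem omegaElt_inv_apply_mem_iff {v : V'} (hv : v ∈ fundPolytope b) {j : b.support}
    (hj : j ∈ minusculeIndices b) : (omegaElt b j)⁻¹ v ∈ fundPolytope b ↔
      P.toLinearMap (P.root j + highestRoot b) v = 1 := by
  have hω := omegaElt_mem_omega hj
  have hinv := pairing_highestRoot_omegaElt_inv hj v
  have hv' := mem_fundPolytope_iff.mp hv
  rw [map_add, LinearMap.add_apply]
  constructor
  · intro h
    have h1 := (mem_fundPolytope_iff.mp h).2 _ hω
    have h2 := hv'.2 _ (inv_mem hω)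
    rw [apply_inv_self] at h1
    linarith
  · intro h
    refine mem_fundPolytope_iff.mpr ⟨apply_mem_alcove (inv_mem hω) hv'.1, fun g hg => ?_⟩
    have := hv'.2 _ (mul_mem hg (inv_mem hω))
    rw [AffineEquiv.coe_mul, Function.comp_apply] at this
    linarith

omit [Finite ι] [P.IsCrystallographic] [P.IsReduced] [P.IsIrreducible] in
variable (b) in
theorem zero_mem_fundPolytope : (0 : V') ∈ fundPolytope b := ⟨zero_mem_alcove b, by simp⟩

omit [Finite ι] [P.IsCrystallographic] [P.IsReduced] [P.IsIrreducible] in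
variable (b) in
theorem convex_fundPolytope : Convex ℝ (fundPolytope b) := by
  have hle : ∀ x : V, Convex ℝ {v | P.toLinearMap x v ≤ 1} := fun x =>
    convex_halfSpace_le (P.toLinearMap x).isLinear 1
  have hge : ∀ x : V, Convex ℝ {v | 0 ≤ P.toLinearMap x v} := fun x =>
    convex_halfSpace_ge (P.toLinearMap x).isLinear 0
  have : fundPolytope b = (⋂ i ∈ {i | b.IsPos i}, {v | 0 ≤ P.toLinearMap (P.root i) v} ∩
      {v | P.toLinearMap (P.root i) v ≤ 1}) ∩
      ⋂ j ∈ minusculeIndices b, {v | P.toLinearMap (P.root j + highestRoot b) v ≤ 1} := by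
    ext v
    simp [fundPolytope, alcove]
  rw [this]
  exact (convex_iInter₂ fun i _ => (hge _).inter (hle _)).inter (convex_iInter₂ fun j _ => hle _)

variable [TopologicalSpace V'] [IsTopologicalAddGroup V'] [ContinuousSMul ℝ V'] [T2Space V']

omit [P.IsReduced] [P.IsIrreducible] [P.IsCrystallographic] [Finite ι] in
variable (b) in
theorem isClosed_fundPolytope : IsClosed (fundPolytope b) := by
  have : FiniteDimensional ℝ V' := b.toCoweightBasis.finiteDimensional_of_finite
  have hc : ∀ x : V, Continuous (P.toLinearMap x) := fun x =>
    (P.toLinearMap x).continuous_of_finiteDimensional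
  have : fundPolytope b = (⋂ i ∈ {i | b.IsPos i}, {v | 0 ≤ P.toLinearMap (P.root i) v} ∩
      {v | P.toLinearMap (P.root i) v ≤ 1}) ∩
      ⋂ j ∈ minusculeIndices b, {v | P.toLinearMap (P.root j + highestRoot b) v ≤ 1} := by
    ext v
    simp [fundPolytope, alcove]
  rw [this]
  exact (isClosed_biInter fun i _ => (isClosed_le continuous_const (hc _)).inter
    (isClosed_le (hc _) continuous_const)).inter
    (isClosed_biInter fun j _ => isClosed_le (hc _) continuous_const)

omit [Finite ι] [P.IsRootSystem] [P.IsReduced] [P.IsIrreducible] [TopologicalSpace V']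
  [IsTopologicalAddGroup V'] [ContinuousSMul ℝ V'] [T2Space V'] in
theorem coe_omega_smul (g : omega b) (z : alcove b) :
    ((g • z : alcove b) : V') = (g : V' ≃ᵃ[ℝ] V') z := rfl

variable (b) in
theorem isTopFundamentalDomain_fundPolytope :
    IsTopFundamentalDomain (omega b) ((↑) ⁻¹' fundPolytope b : Set (alcove b)) where
  isClosed := (isClosed_fundPolytope b).preimage continuous_subtype_val
  isConnected := by
    refine ⟨⟨⟨0, zero_mem_alcove b⟩, zero_mem_fundPolytope b⟩, ?_⟩
    rw [← IsInducing.subtypeVal.isPreconnected_image, Subtype.image_preimage_coe,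
      inter_eq_right.mpr fun v hv => hv.1]
    exact (convex_fundPolytope b).isPreconnected
  interior_inter_eq_empty := by
    intro g hg
    obtain ⟨j, hj, hjg⟩ := exists_eq_omegaElt g.2 (by simpa using hg)
    refine eq_empty_of_forall_notMem fun z hz => ?_
    obtain ⟨u, hu, hsub⟩ := mem_nhds_subtype _ _ _ |>.mp (mem_interior_iff_mem_nhds.mp hz)
    have hwall : ∀ y : alcove b, (y : V') ∈ u →
        P.toLinearMap (P.root j + highestRoot b) y = 1 := by
      intro y hy
      obtain ⟨hyF, y', hy', hyy⟩ := hsub hy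
      have hy0 : (g : V' ≃ᵃ[ℝ] V')⁻¹ (y : V') = (y' : V') := by
        rw [← hyy, coe_omega_smul, inv_apply_self]
      refine (omegaElt_inv_apply_mem_iff (b := b) (v := (y : V')) hyF hj).mp ?_
      rw [hjg, hy0]
      exact hy'
    -- The alcove is star-shaped about $0$, while a linear form equal to $1$ at $z$ is $t<1$ at
    -- $tz$; so no neighbourhood of $z$ in the alcove lies in the wall.
    have ht : Tendsto (fun t : ℝ => t • (z : V')) (𝓝[<] 1) (𝓝 (z : V')) := by
      have : Continuous fun t : ℝ => t • (z : V') := by fun_prop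
      simpa using (this.tendsto 1).mono_left nhdsWithin_le_nhds
    obtain ⟨t, htu, ht0, ht1⟩ := ((ht.eventually hu).and
      (Ioo_mem_nhdsLT (zero_lt_one : (0 : ℝ) < 1))).exists
    have hmem : t • (z : V') ∈ alcove b := by
      intro i hi
      obtain ⟨h1, h2⟩ := z.2 i hi
      rw [map_smul, smul_eq_mul]
      exact ⟨mul_nonneg ht0.le h1, mul_le_one₀ ht1.le h1 h2⟩
    have h1 := hwall ⟨_, hmem⟩ htu
    have h2 := hwall z (mem_of_mem_nhds hu)
    simp only [map_smul, smul_eq_mul, h2, mul_one] at h1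
    exact ht1.ne h1
  iUnion_eq_univ := by
    refine eq_univ_of_forall fun z => mem_iUnion.mpr ?_
    obtain ⟨g, hg, hgz⟩ := exists_apply_mem_fundPolytope z.2
    refine ⟨⟨g, hg⟩⁻¹, (⟨g, hg⟩ : omega b) • z, hgz, ?_⟩
    simp

omit [Finite ι] [P.IsRootSystem] [P.IsCrystallographic] [P.IsReduced] [P.IsIrreducible]
  [T2Space V'] in
theorem exists_pos_add_smul_mem {s : Set V'} {v : V'} (hv : v ∈ interior s) (y : V') :
    ∃ t : ℝ, 0 < t ∧ v + t • y ∈ s := by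
  have ht : Tendsto (fun t : ℝ => v + t • y) (𝓝[>] 0) (𝓝 v) := by
    have : Continuous fun t : ℝ => v + t • y := by fun_prop
    simpa using (this.tendsto 0).mono_left nhdsWithin_le_nhds
  obtain ⟨t, hts, ht0⟩ := ((ht.eventually (mem_interior_iff_mem_nhds.mp hv)).and
    (self_mem_nhdsWithin : Ioi (0 : ℝ) ∈ 𝓝[>] 0)).exists
  exact ⟨t, ht0, hts⟩

omit [Finite ι] [P.IsCrystallographic] [P.IsReduced] [P.IsIrreducible] [T2Space V'] in
-- Moving slightly along $\pm\alpha^\vee$ shifts the value of $\alpha$ both ways, so neither bound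
-- is attained.
theorem mem_openAlcove_of_mem_interior {v : V'} (hv : v ∈ interior (fundPolytope b)) :
    v ∈ openAlcove b := by
  intro i hi
  obtain ⟨t, ht, hmem⟩ := exists_pos_add_smul_mem hv (P.coroot i)
  obtain ⟨s, hs, hmem'⟩ := exists_pos_add_smul_mem hv (-P.coroot i)
  have h1 := (hmem.1 i hi).2
  have h2 := (hmem'.1 i hi).1
  simp only [map_add, map_smul, map_neg, RootPairing.root_coroot_two, smul_eq_mul] at h1 h2
  constructor <;> linarith

omit [T2Space V'] in
theorem apply_notMem_fundPolytope {v : V'} (hv : v ∈ interior (fundPolytope b))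
    {g : V' ≃ᵃ[ℝ] V'} (hg : g ∈ extAffineWeyl b) (hg1 : g ≠ 1) : g v ∉ fundPolytope b := by
  intro hgv
  have hΩ := mem_omega_of_apply_mem hg (mem_openAlcove_of_mem_interior hv) hgv.1
  obtain ⟨j, hj, hjg⟩ := exists_eq_omegaElt (inv_mem hΩ) (inv_ne_one.mpr hg1)
  rw [← inv_inv g, ← hjg, omegaElt_inv_apply_mem_iff (interior_subset hv) hj] at hgv
  -- Moving outward along $v$ itself raises the wall value from $1$ to $1+t$, which leaves $F$.
  obtain ⟨t, ht, hmem⟩ := exists_pos_add_smul_mem hv v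
  have := hmem.2 j hj
  rw [map_add (P.toLinearMap (P.root j + highestRoot b)), map_smul, hgv, smul_eq_mul] at this
  linarith

end Polytope

end ExtAffineWeyl

end

theorem mainTheorem2 {ι V V' : Type*} [Finite ι]
    [AddCommGroup V] [Module ℝ V] [AddCommGroup V'] [Module ℝ V']
    [TopologicalSpace V'] [IsTopologicalAddGroup V'] [ContinuousSMul ℝ V'] [T2Space V']
    (P : RootPairing ι ℝ V V') [P.IsRootSystem] [P.IsCrystallographic] [P.IsReduced]
    [P.IsIrreducible] (b : P.Base) :
    IsTopFundamentalDomain (ExtAffineWeyl.omega b)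
      ((↑) ⁻¹' ExtAffineWeyl.fundPolytope b : Set (ExtAffineWeyl.alcove b)) ∧
    Set.BijOn (ExtAffineWeyl.omegaElt b) (ExtAffineWeyl.minusculeIndices b)
      ((ExtAffineWeyl.omega b : Set (V' ≃ᵃ[ℝ] V')) \ {1}) ∧
    (∀ v ∈ ExtAffineWeyl.fundPolytope b, ∀ j ∈ ExtAffineWeyl.minusculeIndices b,
      ((ExtAffineWeyl.omegaElt b j)⁻¹ v ∈ ExtAffineWeyl.fundPolytope b ↔
        P.toLinearMap (P.root j + ExtAffineWeyl.highestRoot b) v = 1)) ∧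
    (∀ v ∈ interior (ExtAffineWeyl.fundPolytope b), ∀ g ∈ ExtAffineWeyl.extAffineWeyl b,
      g ≠ 1 → g v ∉ ExtAffineWeyl.fundPolytope b) :=
  ⟨ExtAffineWeyl.isTopFundamentalDomain_fundPolytope b, ExtAffineWeyl.bijOn_omegaElt b,
    fun _ hv _ hj => ExtAffineWeyl.omegaElt_inv_apply_mem_iff hv hj,
    fun _ hv _ hg hg1 => ExtAffineWeyl.apply_notMem_fundPolytope hv hg hg1⟩
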